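/- Let $\psi=\Gamma'/\Gamma$ be the digamma function, $G=\sum_{k=0}^\infty\frac{(-1)^k}{(2k+1)^2}$ Catalan's constant, $\zeta$ the Riemann zeta function and $H_r=\sum_{i=1}^r\frac1i$. Let $m$ and $n$ be positive integers with $n\ge m$, and put $$\Theta_1(n,2m+1)=\sum_{k=1}^\infty\frac{\psi\left(\frac{2k+2n+5}{4}\right)-\psi\left(\frac{2k+2n+3}{4}\right)}{(2k+2m+1)^2}.$$ This series converges, and its sum is as follows. (a) If $n=m$: $$\Theta_1(n,2m+1)=-4-4\sum_{k=1}^{m}\sum_{j=0}^{k}\frac{(-1)^{j+k}}{(2j+1)(2k+1)^2}+\left(1+\sum_{j=1}^{m}\frac{(-1)^j}{(2j+1)^2}-G\right)\pi+\frac{\pi^2}{4}\ln 2+\frac74\zeta(3).$$ (b) If $n=m+1$: $$\Theta_1(n,2m+1)=\frac53+4\sum_{k=1}^{m}\sum_{j=0}^{k+1}\frac{(-1)^{j+k}}{(2j+1)(2k+1)^2}-\left(1+\sum_{j=1}^{m}\frac{(-1)^j}{(2j+1)^2}-G\right)\pi+\frac{\pi^2}{4}(1-\ln 2)-\frac74\zeta(3).$$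 (c) If $n=m+2$: $$\Theta_1(n,2m+1)=-\frac{14}{5}-4\sum_{k=1}^{m}\sum_{j=0}^{k+2}\frac{(-1)^{j+k}}{(2j+1)(2k+1)^2}+\left(1+\sum_{j=1}^{m}\frac{(-1)^j}{(2j+1)^2}-G\right)\pi+\left(\ln 2-\frac12\right)\frac{\pi^2}{4}+\frac74\zeta(3).$$ (d) If $n-m$ is odd and $n-m\ne1$: $$\begin{aligned}\Theta_1(n,2m+1)={}&3-\frac18\sum_{j=1}^{\frac{n-m-1}{2}}\frac{(4j+1)(H_{2j-1}-2H_{4j-1})}{j^2(2j+1)^2}-\sum_{j=1}^{\frac{n-m-1}{2}}\frac{1}{(2j+1)^2(4j+1)}\\&-4\sum_{k=1}^{m}\sum_{j=0}^{k+n-m}\frac{(-1)^{k+n-m+j}}{(2k+1)^2(2j+1)}+4\sum_{j=1}^{n-m}\frac{(-1)^j}{2j+1}\\&+\left(-1-\sum_{j=1}^{m}\frac{(-1)^{j+n-m-1}}{(2j+1)^2}+G\right)\pi\\&+\left(1-\ln 2-\frac12\sum_{j=1}^{\frac{n-m-1}{2}}\frac{1}{j(2j+1)}\right)\frac{\pi^2}{4}-\frac74\zeta(3).\end{aligned}$$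 (e) If $n-m$ is even and $n-m\notin\{0,2\}$: $$\begin{aligned}\Theta_1(n,2m+1)={}&-\frac{10}{3}-\frac18\sum_{j=1}^{\frac{n-m-2}{2}}\frac{(4j+3)(H_{2j-1}-2H_{4j-1})}{(j+1)^2(2j+1)^2}-\sum_{j=1}^{\frac{n-m-2}{2}}\frac{4j^3+j^2-4j-2}{(j+1)^2(2j+1)^2(4j+3)(4j+1)}\\&-4\sum_{k=1}^{m}\sum_{j=0}^{k+n-m}\frac{(-1)^{k+n-m+j}}{(2k+1)^2(2j+1)}-4\sum_{j=1}^{n-m}\frac{(-1)^j}{2j+1}\\&-\left(-1+\sum_{j=1}^{m}\frac{(-1)^{j+n-m-1}}{(2j+1)^2}+G\right)\pi+\frac{\pi^2}{4}\left(\ln 2-\frac12\right)\\&-\frac{\pi^2}{8}\sum_{j=1}^{\frac{n-m-2}{2}}\frac{1}{(j+1)(2j+1)}+\frac74\zeta(3).\end{aligned}$$ -/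

import Mathlib

/-- Catalan's constant `G = ∑_{k ≥ 0} (-1)^k / (2k+1)^2`. -/
noncomputable def catalanConst : ℝ := ∑' k : ℕ, (-1 : ℝ) ^ k / (2 * (k : ℝ) + 1) ^ 2

/-- The difference `f(k, n) = ψ((2k+2n+5)/4) - ψ((2k+2n+3)/4)` of values of the digamma
function `ψ = Γ'/Γ`. -/
noncomputable def digammaDiff (k n : ℕ) : ℂ :=
  Complex.digamma ((2 * (k : ℂ) + 2 * (n : ℂ) + 5) / 4) -
    Complex.digamma ((2 * (k : ℂ) + 2 * (n : ℂ) + 3) / 4)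

/-- The assertion that the series
`Θ₁(n, α) = ∑_{k ≥ 1} f(k, n) / (2k+α)^2` converges (absolutely) and has sum `s`;
the summation index `k : ℕ` is shifted by one. -/
def HasThetaOne (n α : ℕ) (s : ℂ) : Prop :=
  HasSum (fun k : ℕ => digammaDiff (k + 1) n / (2 * ((k + 1 : ℕ) : ℂ) + (α : ℂ)) ^ 2) s

open Filter Topology MeasureTheory Set

/-! By the recurrence and the reflection formula for ψ, each digamma difference is a tail of the
Leibniz series for π, namely `leibnizTail (k + n)`. With K = k + m and d = n - m, the series becomes
∑ `leibnizTail (K + d)` / (2K+1)² over K > m, that is, `tailSum d` minus its first m + 1 terms.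
Those terms give the finite double sums and most of the π-terms, so only `tailSum d` remains.

Consecutive Leibniz tails add up to one fraction, so `tailSum d + tailSum (d + 1)` is elementary
(`tailSum_add_succ`). This reduces every d to d = 0. As `tailSum d` tends to 0, the same recurrence
expands `tailSum 0` as an alternating series: (π²/4) ln 2 plus ∑ (-1)^r O_r / r², where O_r is
`oddHarmonic r`.

That last sum is found by evaluating ∫ u²/sin u over [0, π/2] twice: the kernel ∑ sin((2k+1)u) gives
2πG - (7/2)ζ(3), while the Fourier series of u² gives -2 ∑ (-1)^r O_r / r². -/

/-! ### Growth of the odd harmonic numbers. -/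

/-- The odd harmonic number `1 + 1/3 + ⋯ + 1/(2r-1)`. -/
noncomputable def oddHarmonic (r : ℕ) : ℝ := ∑ i ∈ Finset.range r, 1 / (2 * (i : ℝ) + 1)

lemma oddHarmonic_succ (r : ℕ) : oddHarmonic (r + 1) = oddHarmonic r + 1 / (2 * (r : ℝ) + 1) :=
  Finset.sum_range_succ _ _

lemma oddHarmonic_nonneg (r : ℕ) : 0 ≤ oddHarmonic r :=
  Finset.sum_nonneg fun i _ => by positivity

/-- A crude bound, enough for summability of O_r / r²: each 1/(2r+1) is at most the increment of
2√r. -/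
lemma oddHarmonic_le_two_mul_sqrt (r : ℕ) : oddHarmonic r ≤ 2 * √r := by
  induction r with
  | zero => simp [oddHarmonic]
  | succ r ih =>
    rw [oddHarmonic_succ]
    have h1 : √(r : ℝ) ^ 2 = r := Real.sq_sqrt (by positivity)
    have h2 : √((r : ℝ) + 1) ^ 2 = r + 1 := Real.sq_sqrt (by positivity)
    have h3 : 0 ≤ √(r : ℝ) := Real.sqrt_nonneg _
    have h4 : 1 ≤ √((r : ℝ) + 1) := Real.one_le_sqrt.2 (by linarith [Nat.cast_nonneg (α := ℝ) r])
    have h5 : 1 / (2 * (r : ℝ) + 1) ≤ 2 * (√((r : ℝ) + 1) - √r) := by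
      have hle : √((r : ℝ) + 1) + √r ≤ 2 * (2 * r + 1) := by
        nlinarith [sq_nonneg (√(r : ℝ) - 1), sq_nonneg (√((r : ℝ) + 1) - 1)]
      have : √((r : ℝ) + 1) - √r = 1 / (√((r : ℝ) + 1) + √r) := by
        field_simp
        nlinarith
      rw [this, mul_one_div, div_le_div_iff₀ (by positivity) (by positivity)]
      linarith
    push_cast
    linarith

lemma summable_oddHarmonic_div_sq :
    Summable fun r : ℕ => oddHarmonic r / (r : ℝ) ^ 2 := by
  have h : Summable fun r : ℕ => 2 * (1 / (r : ℝ) ^ (3 / 2 : ℝ)) :=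
    (Real.summable_one_div_nat_rpow.2 (by norm_num)).mul_left 2
  refine h.of_nonneg_of_le (fun r => div_nonneg (oddHarmonic_nonneg r) (by positivity)) fun r => ?_
  rcases Nat.eq_zero_or_pos r with rfl | hr
  · simp [oddHarmonic]
  have hr' : (0 : ℝ) < r := by exact_mod_cast hr
  have : (r : ℝ) ^ 2 = r ^ (3 / 2 : ℝ) * √r := by
    rw [Real.sqrt_eq_rpow, ← Real.rpow_add hr']
    norm_num
  rw [this, mul_one_div, div_le_div_iff₀ (by positivity) (by positivity)]
  have := oddHarmonic_le_two_mul_sqrt r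
  have h0 : 0 ≤ (r : ℝ) ^ (3 / 2 : ℝ) := by positivity
  nlinarith

/-! ### The integral of u²/sin u in terms of G and ζ(3). -/

/-- Telescoping of 2 sin u sin((2k+1)u) = cos(2ku) - cos(2(k+1)u). Both evaluations of the integral
rest on it. -/
lemma two_mul_sin_mul_sum_sin_odd (u : ℝ) (N : ℕ) :
    2 * Real.sin u * ∑ k ∈ Finset.range N, Real.sin ((2 * k + 1) * u) = 1 - Real.cos (2 * N * u) := by
  induction N with
  | zero => simp
  | succ N ih =>
    rw [Finset.sum_range_succ, mul_add, ih]
    push_cast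
    rw [show (2 * ((N : ℝ) + 1)) * u = (2 * N + 1) * u + u by ring,
      show (2 * (N : ℝ)) * u = (2 * N + 1) * u - u by ring, Real.cos_add, Real.cos_sub]
    ring

lemma sin_odd_mul_pi_div_two (k : ℕ) : Real.sin ((2 * k + 1) * (Real.pi / 2)) = (-1) ^ k := by
  rw [show (2 * (k : ℝ) + 1) * (Real.pi / 2) = Real.pi / 2 + k * Real.pi by ring,
    Real.sin_add_nat_mul_pi]
  simp

lemma cos_odd_mul_pi_div_two (k : ℕ) : Real.cos ((2 * k + 1) * (Real.pi / 2)) = 0 := by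
  rw [show (2 * (k : ℝ) + 1) * (Real.pi / 2) = Real.pi / 2 + k * Real.pi by ring,
    Real.cos_add_nat_mul_pi]
  simp

lemma integral_sin_odd (k : ℕ) :
    ∫ u in (0 : ℝ)..(Real.pi / 2), Real.sin ((2 * k + 1) * u) = 1 / (2 * k + 1) := by
  rw [intervalIntegral.integral_comp_mul_left _ (by positivity), integral_sin,
    cos_odd_mul_pi_div_two]
  simp

lemma integral_sq_mul_sin_odd (k : ℕ) :
    ∫ u in (0 : ℝ)..(Real.pi / 2), u ^ 2 * Real.sin ((2 * k + 1) * u) =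
      Real.pi * ((-1) ^ k / (2 * k + 1) ^ 2) - 2 * (1 / (2 * k + 1) ^ 3) := by
  set p : ℝ := 2 * k + 1 with hp
  have hp0 : p ≠ 0 := by positivity
  have key : ∀ u ∈ uIcc (0 : ℝ) (Real.pi / 2), HasDerivAt
      (fun u => -u ^ 2 * Real.cos (p * u) / p + 2 * u * Real.sin (p * u) / p ^ 2
        + 2 * Real.cos (p * u) / p ^ 3) (u ^ 2 * Real.sin (p * u)) u := by
    intro u _
    have hl : HasDerivAt (fun u : ℝ => p * u) p u := by
      simpa using (hasDerivAt_id u).const_mul p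
    have hs := hl.sin
    have hc := hl.cos
    have h1 := (((hasDerivAt_id u).pow 2).neg.mul hc).div_const p
    have h2 := (((hasDerivAt_id u).const_mul 2).mul hs).div_const (p ^ 2)
    have h3 := (hc.const_mul 2).div_const (p ^ 3)
    refine ((h1.add h2).add h3).congr_deriv ?_
    simp
    field_simp
    ring
  rw [intervalIntegral.integral_eq_sub_of_hasDerivAt key
    (Continuous.intervalIntegrable (by fun_prop) _ _)]
  have h1 : Real.sin (p * (Real.pi / 2)) = (-1) ^ k := sin_odd_mul_pi_div_two k
  have h2 : Real.cos (p * (Real.pi / 2)) = 0 := cos_odd_mul_pi_div_two k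
  simp only [h1, h2]
  simp
  field_simp

/-- Writing u²/sin u as u / sinc u removes the singularity at 0. -/
lemma continuousOn_div_sinc :
    ContinuousOn (fun u : ℝ => u / Real.sinc u) (Icc 0 (Real.pi / 2)) := by
  refine continuousOn_id.div Real.continuous_sinc.continuousOn fun u hu => ?_
  rcases hu.1.eq_or_lt with h | h
  · simp [← h]
  · rw [Real.sinc_of_ne_zero h.ne']
    exact (div_pos (Real.sin_pos_of_pos_of_lt_pi h (by linarith [hu.2, Real.pi_pos])) h).ne'

lemma intervalIntegrable_div_sinc :
    IntervalIntegrable (fun u : ℝ => u / Real.sinc u) volume 0 (Real.pi / 2) :=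
  ContinuousOn.intervalIntegrable (by
    rw [uIcc_of_le (by positivity)]; exact continuousOn_div_sinc)

/-- The Riemann-Lebesgue lemma for cosine integrals with even frequencies. -/
lemma tendsto_intervalIntegral_mul_cos {a b : ℝ} (hab : a ≤ b) {g : ℝ → ℝ}
    (hg : IntervalIntegrable g volume a b) :
    Tendsto (fun N : ℕ => ∫ u in a..b, g u * Real.cos (2 * N * u)) atTop (𝓝 0) := by
  have hgi : Integrable ((Ioc a b).indicator fun u => (g u : ℂ)) :=
    (integrable_indicator_iff measurableSet_Ioc).2
      ((intervalIntegrable_iff_integrableOn_Ioc_of_le hab).1 hg).ofReal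
  have hRL := Real.tendsto_integral_exp_smul_cocompact
    ((Ioc a b).indicator fun u => (g u : ℂ))
  -- At frequency N/π the Fourier character has real part cos(2Nu).
  have hfreq : Tendsto (fun N : ℕ => (N : ℝ) / Real.pi) atTop (cocompact ℝ) :=
    (tendsto_natCast_atTop_atTop.atTop_div_const Real.pi_pos).mono_right atTop_le_cocompact
  have h := (Complex.continuous_re.tendsto _).comp (hRL.comp hfreq)
  rw [Complex.zero_re] at h
  refine h.congr fun N => ?_
  simp only [Function.comp_apply]
  rw [intervalIntegral.integral_of_le hab, ← integral_indicator measurableSet_Ioc]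
  rw [← RCLike.re_eq_complex_re, ← integral_re]
  · refine integral_congr_ae (Eventually.of_forall fun u => ?_)
    by_cases hu : u ∈ Ioc a b
    · simp only [hu, indicator_of_mem, Circle.smul_def, Real.fourierChar_apply]
      simp [Complex.exp_re, mul_comm]
      left
      congr 1
      field_simp
    · simp [hu]
  · simpa [mul_comm] using (Real.fourierIntegral_convergent_iff ((N : ℝ) / Real.pi)).2 hgi

/-- The kernel identity multiplied by u²/sin u and integrated; the cosine integral is the remainder
that Riemann-Lebesgue kills. -/
lemma integral_div_sinc_sub (N : ℕ) :
    (∫ u in (0 : ℝ)..(Real.pi / 2), u / Real.sinc u) -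
      ∫ u in (0 : ℝ)..(Real.pi / 2), u / Real.sinc u * Real.cos (2 * N * u) =
    2 * Real.pi * ∑ k ∈ Finset.range N, (-1 : ℝ) ^ k / (2 * (k : ℝ) + 1) ^ 2 -
      4 * ∑ k ∈ Finset.range N, 1 / (2 * (k : ℝ) + 1) ^ 3 := by
  have hi : IntervalIntegrable (fun u : ℝ => u / Real.sinc u * Real.cos (2 * N * u))
      volume 0 (Real.pi / 2) :=
    intervalIntegrable_div_sinc.mul_continuousOn (by fun_prop)
  rw [← intervalIntegral.integral_sub intervalIntegrable_div_sinc hi]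
  have : ∫ u in (0 : ℝ)..(Real.pi / 2),
      (u / Real.sinc u - u / Real.sinc u * Real.cos (2 * N * u)) =
      ∫ u in (0 : ℝ)..(Real.pi / 2),
        ∑ k ∈ Finset.range N, 2 * (u ^ 2 * Real.sin ((2 * k + 1) * u)) := by
    refine intervalIntegral.integral_congr_ae (Eventually.of_forall fun u hu => ?_)
    rw [uIoc_of_le (by positivity)] at hu
    have hs := Real.sin_pos_of_pos_of_lt_pi hu.1 (by linarith [hu.2, Real.pi_pos])
    have hu0 := hu.1.ne'
    have hid := two_mul_sin_mul_sum_sin_odd u N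
    rw [Real.sinc_of_ne_zero hu0, ← Finset.mul_sum, ← Finset.mul_sum]
    have : Real.cos (2 * N * u) =
      1 - 2 * Real.sin u * ∑ k ∈ Finset.range N, Real.sin ((2 * k + 1) * u) := by linarith
    rw [this]
    field_simp
    ring
  rw [this, intervalIntegral.integral_finsetSum
    fun k _ => Continuous.intervalIntegrable (by fun_prop) _ _]
  simp only [intervalIntegral.integral_const_mul, integral_sq_mul_sin_odd]
  rw [Finset.mul_sum, Finset.mul_sum, ← Finset.sum_sub_distrib]
  exact Finset.sum_congr rfl fun k _ => by ring

lemma summable_one_div_odd_pow {s : ℕ} (hs : 1 < s) :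
    Summable fun k : ℕ => 1 / (2 * (k : ℝ) + 1) ^ s := by
  have := (Real.summable_one_div_nat_pow.2 hs).comp_injective
    (i := fun k : ℕ => 2 * k + 1) (fun a b h => by simpa using h)
  refine this.congr fun k => ?_
  simp

lemma hasSum_one_div_odd_pow {s : ℕ} (hs : 1 < s) :
    HasSum (fun k : ℕ => 1 / (2 * (k : ℝ) + 1) ^ s)
      ((1 - 1 / 2 ^ s) * ∑' n : ℕ, 1 / (n : ℝ) ^ s) := by
  have hz := (Real.summable_one_div_nat_pow.2 hs).hasSum
  have he : HasSum (fun k : ℕ => 1 / ((2 * k : ℕ) : ℝ) ^ s)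
      (1 / 2 ^ s * ∑' n : ℕ, 1 / (n : ℝ) ^ s) := by
    refine (hz.mul_left (1 / 2 ^ s)).congr_fun ?_
    intro k
    push_cast
    rw [mul_pow]
    field_simp
  have ho : HasSum (fun k : ℕ => 1 / ((2 * k + 1 : ℕ) : ℝ) ^ s)
      (∑' k : ℕ, 1 / (2 * (k : ℝ) + 1) ^ s) := by
    simpa using (summable_one_div_odd_pow hs).hasSum
  have := (he.even_add_odd (f := fun n : ℕ => 1 / (n : ℝ) ^ s) ho).unique hz
  have h2 := (summable_one_div_odd_pow hs).hasSum
  convert h2 using 1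
  linarith

lemma hasSum_one_div_odd_sq :
    HasSum (fun k : ℕ => 1 / (2 * (k : ℝ) + 1) ^ 2) (Real.pi ^ 2 / 8) := by
  have := hasSum_one_div_odd_pow (s := 2) one_lt_two
  rw [hasSum_zeta_two.tsum_eq] at this
  convert this using 1
  ring

lemma hasSum_catalanConst :
    HasSum (fun k : ℕ => (-1 : ℝ) ^ k / (2 * (k : ℝ) + 1) ^ 2) catalanConst := by
  refine Summable.hasSum (Summable.of_norm ((summable_one_div_odd_pow one_lt_two).congr fun k => ?_))
  simp [abs_of_pos (show (0 : ℝ) < 2 * k + 1 by positivity)]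

lemma integral_div_sinc :
    ∫ u in (0 : ℝ)..(Real.pi / 2), u / Real.sinc u =
      2 * Real.pi * catalanConst - 7 / 2 * ∑' n : ℕ, 1 / (n : ℝ) ^ 3 := by
  have h1 := (tendsto_intervalIntegral_mul_cos (by positivity)
    intervalIntegrable_div_sinc).const_sub
      (∫ u in (0 : ℝ)..(Real.pi / 2), u / Real.sinc u)
  have h2 := (hasSum_catalanConst.tendsto_sum_nat.const_mul (2 * Real.pi)).sub
    ((hasSum_one_div_odd_pow (s := 3) (by norm_num)).tendsto_sum_nat.const_mul 4)
  have := tendsto_nhds_unique (h1.congr integral_div_sinc_sub) h2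
  linarith

/-! ### The alternating sum of O_r / r². -/

/-- The Fourier series of the Bernoulli polynomial B₂ at u/π + 1/2; the half-period shift creates
the sign (-1)^r. -/
lemma hasSum_neg_one_pow_mul_cos {u : ℝ} (hu : u ∈ Icc 0 (Real.pi / 2)) :
    HasSum (fun r : ℕ => (-1 : ℝ) ^ r / (r : ℝ) ^ 2 * Real.cos (2 * r * u))
      (u ^ 2 - Real.pi ^ 2 / 12) := by
  have hpi := Real.pi_pos
  have hx : u / Real.pi + 1 / 2 ∈ Icc (0 : ℝ) 1 := by
    refine ⟨add_nonneg (div_nonneg hu.1 hpi.le) (by norm_num), ?_⟩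
    have : u / Real.pi ≤ 1 / 2 := by
      rw [div_le_iff₀ hpi]; linarith [hu.2]
    linarith
  have h := hasSum_one_div_nat_pow_mul_cos one_ne_zero hx
  have hB : (Polynomial.map (algebraMap ℚ ℝ) (Polynomial.bernoulli 2)).eval (u / Real.pi + 1 / 2)
      = (u / Real.pi + 1 / 2) ^ 2 - (u / Real.pi + 1 / 2) + 1 / 6 := by
    simp [Polynomial.bernoulli, Finset.sum_range_succ, bernoulli_two, bernoulli_one]
    norm_num [Nat.choose]
    ring
  rw [mul_one, hB] at h
  convert h using 1
  · ext r
    rw [show 2 * Real.pi * r * (u / Real.pi + 1 / 2) = 2 * r * u + r * Real.pi by field_simp,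
      Real.cos_add_nat_mul_pi]
    ring
  · field_simp
    norm_num [Nat.factorial]
    ring

/-- Subtracting the value at 0 makes every term divisible by sin u. -/
lemma hasSum_sq {u : ℝ} (hu : u ∈ Icc 0 (Real.pi / 2)) :
    HasSum (fun r : ℕ => (-1 : ℝ) ^ r / (r : ℝ) ^ 2 * (Real.cos (2 * r * u) - 1)) (u ^ 2) := by
  have h0 := hasSum_neg_one_pow_mul_cos (u := 0) ⟨le_rfl, by positivity⟩
  have h := (hasSum_neg_one_pow_mul_cos hu).sub h0
  rw [show u ^ 2 = u ^ 2 - Real.pi ^ 2 / 12 - (0 ^ 2 - Real.pi ^ 2 / 12) by ring]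
  refine h.congr_fun fun r => ?_
  simp
  ring

lemma integral_sum_sin_odd (r : ℕ) :
    ∫ u in (0 : ℝ)..(Real.pi / 2), ∑ k ∈ Finset.range r, Real.sin ((2 * k + 1) * u) =
      oddHarmonic r := by
  rw [intervalIntegral.integral_finsetSum
    fun k _ => Continuous.intervalIntegrable (by fun_prop) _ _]
  simp only [integral_sin_odd, oddHarmonic]

lemma sum_sin_odd_nonneg {u : ℝ} (hu : u ∈ Ioc 0 (Real.pi / 2)) (r : ℕ) :
    0 ≤ ∑ k ∈ Finset.range r, Real.sin ((2 * k + 1) * u) := by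
  have hs := Real.sin_pos_of_pos_of_lt_pi hu.1 (by linarith [hu.2, Real.pi_pos])
  have := two_mul_sin_mul_sum_sin_odd u r
  refine (mul_nonneg_iff_of_pos_left (c := 2 * Real.sin u) (by positivity)).1 ?_
  rw [this]
  linarith [Real.cos_le_one (2 * r * u)]

/-- Divide the series of u² by sin u and integrate termwise: (1 - cos 2ru)/(2 sin u) is a sine sum
with integral O_r. -/
lemma hasSum_neg_one_pow_mul_oddHarmonic :
    HasSum (fun r : ℕ => (-1 : ℝ) ^ r * (oddHarmonic r / (r : ℝ) ^ 2))
      (7 / 4 * (∑' n : ℕ, 1 / (n : ℝ) ^ 3) - Real.pi * catalanConst) := by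
  set μ := volume.restrict (Ioc (0 : ℝ) (Real.pi / 2))
  set S : ℕ → ℝ → ℝ := fun r u => ∑ k ∈ Finset.range r, Real.sin ((2 * k + 1) * u)
  have hle : (0 : ℝ) ≤ Real.pi / 2 := by positivity
  have hS (r : ℕ) : ∫ u, S r u ∂μ = oddHarmonic r := by
    rw [← integral_sum_sin_odd, intervalIntegral.integral_of_le hle]
  have hSi (r : ℕ) : Integrable (S r) μ :=
    (intervalIntegrable_iff_integrableOn_Ioc_of_le hle).1
      (Continuous.intervalIntegrable (by fun_prop) _ _)
  set F : ℕ → ℝ → ℝ := fun r u => (-2 * ((-1 : ℝ) ^ r / (r : ℝ) ^ 2)) * S r u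
  have hF (r : ℕ) : ∫ u, F r u ∂μ = -2 * ((-1 : ℝ) ^ r * (oddHarmonic r / (r : ℝ) ^ 2)) := by
    rw [integral_const_mul, hS]; ring
  -- The sine sums are nonnegative on the interval, so the L¹ norms are exact and summable, which
  -- justifies the interchange.
  have hFn (r : ℕ) : ∫ u, ‖F r u‖ ∂μ = 2 * (oddHarmonic r / (r : ℝ) ^ 2) := by
    have : ∫ u, ‖F r u‖ ∂μ = ∫ u, (2 / (r : ℝ) ^ 2) * S r u ∂μ := by
      refine setIntegral_congr_fun measurableSet_Ioc fun u hu => ?_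
      simp only [F, norm_mul, Real.norm_eq_abs, abs_of_nonneg (sum_sin_odd_nonneg hu r), S]
      simp [div_eq_mul_inv]
    rw [this, integral_const_mul, hS]; ring
  have key := hasSum_integral_of_summable_integral_norm (F := F) (μ := μ)
    (fun r => (hSi r).const_mul _)
    ((summable_oddHarmonic_div_sq.mul_left 2).congr fun r => (hFn r).symm)
  have hlim : ∫ u, ∑' r, F r u ∂μ = ∫ u in (0 : ℝ)..(Real.pi / 2), u / Real.sinc u := by
    rw [intervalIntegral.integral_of_le hle]
    refine setIntegral_congr_fun measurableSet_Ioc fun u hu => ?_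
    have hs := Real.sin_pos_of_pos_of_lt_pi hu.1 (by linarith [hu.2, Real.pi_pos])
    have h := (hasSum_sq ⟨hu.1.le, hu.2⟩).div_const (Real.sin u)
    have : u / Real.sinc u = u ^ 2 / Real.sin u := by
      rw [Real.sinc_of_ne_zero hu.1.ne']
      field_simp
    simp only [this]
    rw [← h.tsum_eq]
    refine tsum_congr fun r => ?_
    have hid := two_mul_sin_mul_sum_sin_odd u r
    rw [show Real.cos (2 * r * u) - 1 = -(2 * Real.sin u * S r u) by simp only [S]; linarith]
    simp only [F]
    field_simp
  rw [hlim, integral_div_sinc] at key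
  simp only [hF] at key
  rw [show ∀ z : ℝ, 7 / 4 * z - Real.pi * catalanConst =
    -1 / 2 * (2 * Real.pi * catalanConst - 7 / 2 * z) from fun z => by ring]
  refine (key.mul_left (-1 / 2)).congr_fun fun r => ?_
  ring

/-! ### Digamma differences as Leibniz tails. -/

/-- Euler's reflection formula for the digamma function. -/
lemma Complex.digamma_one_sub_sub_digamma {z : ℂ} (h0 : ∀ m : ℕ, z ≠ -m)
    (h1 : ∀ m : ℕ, 1 - z ≠ -m) :
    digamma (1 - z) - digamma z = Real.pi * cos (Real.pi * z) / sin (Real.pi * z) := by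
  have hg0 := Gamma_ne_zero h0
  have hg1 := Gamma_ne_zero h1
  have hs : sin (Real.pi * z) ≠ 0 := by
    intro h
    have := Gamma_mul_Gamma_one_sub z
    rw [h, div_zero] at this
    exact mul_ne_zero hg0 hg1 this
  have hpi : (Real.pi : ℂ) ≠ 0 := by exact_mod_cast Real.pi_ne_zero
  have hd0 := (differentiableAt_Gamma z h0).hasDerivAt
  have hd1 : HasDerivAt (fun w => Gamma (1 - w)) (deriv Gamma (1 - z) * (-1)) z := by
    have := (differentiableAt_Gamma (1 - z) h1).hasDerivAt
    exact this.comp z ((hasDerivAt_id z).const_sub 1)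
  have hl := hd0.mul hd1
  have hsin : HasDerivAt (fun w => sin (Real.pi * w)) (cos (Real.pi * z) * Real.pi) z := by
    have : HasDerivAt (fun w : ℂ => (Real.pi : ℂ) * w) Real.pi z := by
      simpa using (hasDerivAt_id z).const_mul (Real.pi : ℂ)
    exact (hasDerivAt_sin _).comp z this
  have hr := (hasDerivAt_const z (Real.pi : ℂ)).div hsin hs
  -- Both sides of Γ(w)Γ(1-w) = π/sin(πw) are differentiated; uniqueness of the derivative gives the
  -- formula.
  have heq : (Gamma * fun w => Gamma (1 - w)) =
      ((fun _ => (Real.pi : ℂ)) / fun w => sin (Real.pi * w)) :=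
    funext fun w => Gamma_mul_Gamma_one_sub w
  rw [heq] at hl
  have hu := hl.unique hr
  have hG := Gamma_mul_Gamma_one_sub z
  rw [digamma_def, logDeriv_apply, logDeriv_apply]
  rw [eq_div_iff hs] at hG
  have hG' : Gamma z * Gamma (1 - z) = Real.pi / sin (Real.pi * z) := by
    rw [eq_div_iff hs, hG]
  have : deriv Gamma (1 - z) / Gamma (1 - z) - deriv Gamma z / Gamma z =
      -(deriv Gamma z * Gamma (1 - z) + Gamma z * (deriv Gamma (1 - z) * -1)) /
        (Gamma z * Gamma (1 - z)) := by
    field_simp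
    ring
  rw [this, hu, hG']
  field_simp
  ring

/-- The tail `4 ∑_{i ≥ 0} (-1)^i / (2N+2i+3)` of the Leibniz series, in closed form. -/
noncomputable def leibnizTail (N : ℕ) : ℝ :=
  (-1) ^ (N + 1) * (Real.pi - 4 * ∑ j ∈ Finset.range (N + 1), (-1 : ℝ) ^ j / (2 * (j : ℝ) + 1))

lemma leibnizTail_add_succ (N : ℕ) :
    leibnizTail N + leibnizTail (N + 1) = 4 / (2 * (N : ℝ) + 3) := by
  have h : ((-1 : ℝ) ^ (N + 1)) ^ 2 = 1 := by rw [← pow_mul, mul_comm, pow_mul]; simp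
  unfold leibnizTail
  rw [Finset.sum_range_succ _ (N + 1), pow_succ _ (N + 1)]
  generalize (-1 : ℝ) ^ (N + 1) = e at *
  push_cast
  rw [show 2 * ((N : ℝ) + 1) + 1 = 2 * N + 3 by ring]
  have : (2 * (N : ℝ) + 3) ≠ 0 := by positivity
  field_simp
  linear_combination 4 * h

lemma natCast_add_div_four_ne_neg (N a : ℕ) (ha : 0 < a) (m : ℕ) :
    (2 * (N : ℂ) + a) / 4 ≠ -m := by
  intro h
  have h2 : ((2 * N + a + 4 * m : ℕ) : ℂ) = 0 := by
    push_cast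
    linear_combination 4 * h
  have : 2 * N + a + 4 * m = 0 := by exact_mod_cast h2
  omega

/-- Raising N by one swaps the two arguments, except that the smaller one also grows by 1; so both
sides obey the same recurrence. The base case is reflection at 1/4, where the cotangent is 1. -/
lemma digamma_sub_digamma_eq_leibnizTail (N : ℕ) :
    Complex.digamma ((2 * (N : ℂ) + 5) / 4) - Complex.digamma ((2 * (N : ℂ) + 3) / 4) =
      (leibnizTail N : ℂ) := by
  induction N with
  | zero =>
    have h0 : ∀ m : ℕ, (1 / 4 : ℂ) ≠ -m := by
      simpa using natCast_add_div_four_ne_neg 0 1 one_pos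
    have h1 : ∀ m : ℕ, (1 - 1 / 4 : ℂ) ≠ -m := by
      have := natCast_add_div_four_ne_neg 0 3 (by norm_num)
      norm_num at this ⊢
      exact this
    have hr := Complex.digamma_one_sub_sub_digamma h0 h1
    have ha := Complex.digamma_apply_add_one _ h0
    have hcs : Complex.cos (Real.pi * (1 / 4)) / Complex.sin (Real.pi * (1 / 4)) = 1 := by
      rw [show (Real.pi : ℂ) * (1 / 4) = ((Real.pi / 4 : ℝ) : ℂ) by push_cast; ring,
        ← Complex.ofReal_cos, ← Complex.ofReal_sin, Real.cos_pi_div_four, Real.sin_pi_div_four]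
      refine div_self ?_
      simp
    rw [mul_div_assoc, hcs] at hr
    norm_num [leibnizTail] at hr ha ⊢
    rw [ha]
    linear_combination -hr
  | succ N ih =>
    have ha := Complex.digamma_apply_add_one _
      (by simpa using natCast_add_div_four_ne_neg N 3 (by norm_num))
    have hrec : ((leibnizTail N : ℝ) : ℂ) + (leibnizTail (N + 1) : ℝ) = 4 / (2 * (N : ℂ) + 3) := by
      simpa using congrArg (fun x : ℝ => (x : ℂ)) (leibnizTail_add_succ N)
    rw [inv_div] at ha
    push_cast
    rw [show (2 * ((N : ℂ) + 1) + 5) / 4 = (2 * N + 3) / 4 + 1 by ring,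
      show (2 * ((N : ℂ) + 1) + 3) / 4 = (2 * N + 5) / 4 by ring, ha]
    linear_combination -hrec - ih

lemma digammaDiff_eq_leibnizTail (k n : ℕ) : digammaDiff k n = (leibnizTail (k + n) : ℂ) := by
  rw [← digamma_sub_digamma_eq_leibnizTail, digammaDiff]
  push_cast
  simp only [mul_add]

lemma tendsto_leibnizTail : Tendsto leibnizTail atTop (𝓝 0) := by
  have h := ((tendsto_add_atTop_iff_nat 1).2 Real.tendsto_sum_pi_div_four).const_mul 4
    |>.const_sub Real.pi
  rw [show Real.pi - 4 * (Real.pi / 4) = 0 by ring] at h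
  refine squeeze_zero_norm (fun N => ?_) (by simpa using h.norm)
  simp [leibnizTail]

lemma exists_abs_leibnizTail_le : ∃ C, ∀ N, |leibnizTail N| ≤ C := by
  obtain ⟨C, hC⟩ := tendsto_leibnizTail.abs.bddAbove_range
  exact ⟨C, fun N => hC ⟨N, rfl⟩⟩

/-! ### The sums `tailSum d` and their recurrence. -/

/-- The sum `∑_{K ≥ 0} leibnizTail (K + d) / (2K+1)^2`. -/
noncomputable def tailSum (d : ℕ) : ℝ := ∑' K : ℕ, leibnizTail (K + d) / (2 * (K : ℝ) + 1) ^ 2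

lemma hasSum_tailSum (d : ℕ) :
    HasSum (fun K : ℕ => leibnizTail (K + d) / (2 * (K : ℝ) + 1) ^ 2) (tailSum d) := by
  obtain ⟨C, hC⟩ := exists_abs_leibnizTail_le
  refine Summable.hasSum (Summable.of_norm_bounded
    ((summable_one_div_odd_pow one_lt_two).mul_left C) fun K => ?_)
  rw [Real.norm_eq_abs, abs_div, abs_of_pos (show (0 : ℝ) < (2 * (K : ℝ) + 1) ^ 2 by positivity),
    mul_one_div]
  gcongr
  exact hC _

/-- Dominated convergence: the Leibniz tails are bounded and tend to 0. -/
lemma tendsto_tailSum : Tendsto tailSum atTop (𝓝 0) := by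
  obtain ⟨C, hC⟩ := exists_abs_leibnizTail_le
  have h := tendsto_tsum_of_dominated_convergence (𝓕 := atTop)
    (f := fun d K : ℕ => leibnizTail (K + d) / (2 * (K : ℝ) + 1) ^ 2) (g := fun _ => (0 : ℝ))
    ((summable_one_div_odd_pow one_lt_two).mul_left C) (fun K => ?_)
    (Eventually.of_forall fun d K => ?_)
  · rw [tsum_zero] at h
    exact h
  · have := (tendsto_leibnizTail.comp (tendsto_add_atTop_nat K)).div_const ((2 * (K : ℝ) + 1) ^ 2)
    simpa [Function.comp_def, add_comm] using this
  · rw [Real.norm_eq_abs, abs_div, abs_of_pos (show (0 : ℝ) < (2 * (K : ℝ) + 1) ^ 2 by positivity),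
      mul_one_div]
    gcongr
    exact hC _

lemma hasSum_one_div_odd_sub_shift (r : ℕ) :
    HasSum (fun K : ℕ => 1 / (2 * (K : ℝ) + 1) - 1 / (2 * (K : ℝ) + 2 * r + 1)) (oddHarmonic r) := by
  induction r with
  | zero => simp [oddHarmonic]
  | succ r ih =>
    have hstep : HasSum (fun K : ℕ => 1 / (2 * (K : ℝ) + 2 * r + 1) - 1 / (2 * (K : ℝ) + 2 * r + 3))
        (1 / (2 * (r : ℝ) + 1)) := by
      rw [hasSum_iff_tendsto_nat_of_nonneg]
      · have hlim : Tendsto (fun n : ℕ => 1 / (2 * (r : ℝ) + 1) - 1 / (2 * (n : ℝ) + 2 * r + 1))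
            atTop (𝓝 (1 / (2 * (r : ℝ) + 1) - 0)) := by
          refine Tendsto.const_sub _ ?_
          simp only [one_div, add_assoc]
          exact (tendsto_atTop_add_const_right _ _
            (tendsto_natCast_atTop_atTop.const_mul_atTop two_pos)).inv_tendsto_atTop
        rw [sub_zero] at hlim
        refine hlim.congr fun n => ?_
        induction n with
        | zero => simp
        | succ n ihn =>
          rw [Finset.sum_range_succ, ← ihn]
          push_cast
          rw [show 2 * ((n : ℝ) + 1) + 2 * r + 1 = 2 * n + 2 * r + 3 by ring]
          ring
      · intro K
        rw [sub_nonneg]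
        gcongr
        norm_num
    rw [oddHarmonic_succ]
    refine (ih.add hstep).congr_fun fun K => ?_
    push_cast
    rw [show 2 * (K : ℝ) + 2 * (r + 1) + 1 = 2 * K + 2 * r + 3 by ring]
    ring

/-- With x = 2K+1 and e = d+1, the summand is 4/(x²(x+2e)) = (2/e)/x² - (1/e²)(1/x - 1/(x+2e)). The
first part sums by ∑ 1/x² = π²/8, the second telescopes to O_e. -/
lemma tailSum_add_succ (d : ℕ) :
    tailSum d + tailSum (d + 1) =
      Real.pi ^ 2 / (4 * ((d : ℝ) + 1)) - oddHarmonic (d + 1) / ((d : ℝ) + 1) ^ 2 := by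
  have hd : ((d : ℝ) + 1) ≠ 0 := by positivity
  have h1 := (hasSum_one_div_odd_sq.mul_left (2 / ((d : ℝ) + 1))).sub
    ((hasSum_one_div_odd_sub_shift (d + 1)).mul_left (1 / ((d : ℝ) + 1) ^ 2))
  have h2 := (hasSum_tailSum d).add (hasSum_tailSum (d + 1))
  have h3 := h2.unique (h1.congr_fun fun K => ?_)
  · rw [h3]
    field_simp
    ring
  · rw [← add_div, ← add_assoc K d 1, leibnizTail_add_succ]
    push_cast
    have e1 : (2 * (K : ℝ) + 1) ≠ 0 := by positivity
    have e2 : (2 * (K : ℝ) + 2 * (d + 1) + 1) ≠ 0 := by positivity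
    rw [show 2 * ((K : ℝ) + d) + 3 = 2 * (K : ℝ) + 2 * (d + 1) + 1 by ring]
    field_simp
    ring

/-! ### The value of `tailSum 0`. -/

lemma harmonic_two_mul (n : ℕ) :
    ((harmonic (2 * n) : ℚ) : ℝ) = oddHarmonic n + ((harmonic n : ℚ) : ℝ) / 2 := by
  induction n with
  | zero => simp [oddHarmonic]
  | succ n ih =>
    rw [show 2 * (n + 1) = 2 * n + 1 + 1 by ring, harmonic_succ, harmonic_succ, harmonic_succ,
      oddHarmonic_succ]
    push_cast
    rw [ih, show 2 * (n : ℝ) + 1 + 1 = 2 * (n + 1) by ring]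
    field_simp
    ring

/-- The even partial sums are H_{2n} - H_n, so Euler's constant cancels and ln(2n) - ln n is left.
-/
lemma tendsto_alternating_harmonic :
    Tendsto (fun n : ℕ => ∑ r ∈ Finset.range (2 * n), (-1 : ℝ) ^ r / ((r : ℝ) + 1)) atTop
      (𝓝 (Real.log 2)) := by
  have h := Real.tendsto_harmonic_sub_log
  have h2 : Tendsto (fun n : ℕ => 2 * n) atTop atTop :=
    tendsto_id.const_mul_atTop' two_pos
  have h3 := ((h.comp h2).sub h).add_const (Real.log 2)
  rw [sub_self, zero_add] at h3
  refine h3.congr' ?_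
  filter_upwards [eventually_gt_atTop 0] with n hn
  have hn' : (n : ℝ) ≠ 0 := by positivity
  have hs : ∀ n : ℕ, ∑ r ∈ Finset.range (2 * n), (-1 : ℝ) ^ r / ((r : ℝ) + 1) =
      (harmonic (2 * n) : ℝ) - harmonic n := by
    intro n
    induction n with
    | zero => simp
    | succ n ih =>
      rw [show 2 * (n + 1) = 2 * n + 1 + 1 by ring, Finset.sum_range_succ, Finset.sum_range_succ,
        ih, harmonic_succ, harmonic_succ, harmonic_succ, pow_succ, pow_mul]
      push_cast
      rw [show 2 * (n : ℝ) + 1 + 1 = 2 * (n + 1) by ring]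
      field_simp
      simp
      ring
  rw [hs]
  simp only [Function.comp_apply]
  push_cast
  rw [Real.log_mul two_ne_zero hn']
  ring

lemma tailSum_zero_eq_sum_add (d : ℕ) :
    tailSum 0 = ∑ r ∈ Finset.range d, (-1 : ℝ) ^ r * (Real.pi ^ 2 / (4 * ((r : ℝ) + 1))
      - oddHarmonic (r + 1) / ((r : ℝ) + 1) ^ 2) + (-1) ^ d * tailSum d := by
  induction d with
  | zero => simp
  | succ d ih =>
    rw [Finset.sum_range_succ, ← tailSum_add_succ, ih]
    ring

/-- Unroll the recurrence 2n times and let n tend to infinity; the remainder `tailSum (2 * n)`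
vanishes. -/
lemma tailSum_zero :
    tailSum 0 = Real.pi ^ 2 / 4 * Real.log 2 +
      (7 / 4 * (∑' n : ℕ, 1 / (n : ℝ) ^ 3) - Real.pi * catalanConst) := by
  have h2 : Tendsto (fun n : ℕ => 2 * n) atTop atTop := tendsto_id.const_mul_atTop' two_pos
  have h1 := (hasSum_neg_one_pow_mul_oddHarmonic.tendsto_sum_nat.comp
    (tendsto_add_atTop_nat 1)).comp h2
  have h := ((tendsto_alternating_harmonic.const_mul (Real.pi ^ 2 / 4)).add h1).add
    (tendsto_tailSum.comp h2)
  rw [add_zero] at h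
  refine tendsto_nhds_unique (tendsto_const_nhds.congr fun n => ?_) h
  rw [tailSum_zero_eq_sum_add (2 * n)]
  simp only [Function.comp_apply]
  -- The r = 0 term of the O_r / r² series is 0, by division by zero; removing it aligns the
  -- indices.
  rw [Finset.sum_range_succ' _ (2 * n), Finset.mul_sum]
  simp only [Nat.cast_zero, ne_eq, OfNat.ofNat_ne_zero, not_false_eq_true, zero_pow, div_zero,
    mul_zero, add_zero, pow_mul, neg_one_sq, one_pow, one_mul]
  rw [← Finset.sum_add_distrib]
  congr 1
  refine Finset.sum_congr rfl fun r _ => ?_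
  push_cast
  have : (r : ℝ) + 1 ≠ 0 := by positivity
  field_simp
  ring

lemma ofReal_tailSum_zero :
    (tailSum 0 : ℂ) = (Real.pi : ℂ) ^ 2 / 4 * (Real.log 2 : ℂ) + 7 / 4 * riemannZeta 3 -
      (Real.pi : ℂ) * (catalanConst : ℂ) := by
  have hz : riemannZeta 3 = ((∑' n : ℕ, 1 / (n : ℝ) ^ 3 : ℝ) : ℂ) := by
    have := zeta_nat_eq_tsum_of_gt_one (k := 3) (by norm_num)
    push_cast at this ⊢
    exact this
  rw [tailSum_zero, hz]
  push_cast
  ring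

/-! ### Closed forms of `tailSum d` by parity of d. -/

lemma tailSum_succ (d : ℕ) :
    tailSum (d + 1) =
      Real.pi ^ 2 / (4 * ((d : ℝ) + 1)) - oddHarmonic (d + 1) / ((d : ℝ) + 1) ^ 2 - tailSum d := by
  rw [← tailSum_add_succ]; ring

lemma tailSum_one : tailSum 1 = Real.pi ^ 2 / 4 - 1 - tailSum 0 := by
  rw [tailSum_succ]
  norm_num [oddHarmonic]

lemma tailSum_two : tailSum 2 = tailSum 0 - Real.pi ^ 2 / 8 + 2 / 3 := by
  rw [tailSum_succ, tailSum_one]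
  norm_num [oddHarmonic, Finset.sum_range_succ]
  ring

/-- H_{2j} - 2H_{4j} equals -2 O_{2j}, and dropping the last terms 1/(2j) and 2/(4j) changes
nothing. -/
lemma harmonic_sub_two_mul_harmonic (j : ℕ) (hj : 1 ≤ j) :
    ((harmonic (2 * j - 1) : ℚ) : ℝ) - 2 * ((harmonic (4 * j - 1) : ℚ) : ℝ) =
      -2 * oddHarmonic (2 * j) := by
  obtain ⟨i, rfl⟩ := Nat.exists_eq_add_of_le' hj
  have h := harmonic_two_mul (2 * (i + 1))
  have e1 : harmonic (2 * (i + 1)) = harmonic (2 * (i + 1) - 1) + (2 * ((i : ℚ) + 1))⁻¹ := by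
    conv_lhs => rw [show 2 * (i + 1) = 2 * (i + 1) - 1 + 1 by omega, harmonic_succ,
      show 2 * (i + 1) - 1 + 1 = 2 * (i + 1) by omega]
    push_cast
    rfl
  have e2 : harmonic (4 * (i + 1)) = harmonic (4 * (i + 1) - 1) + (4 * ((i : ℚ) + 1))⁻¹ := by
    conv_lhs => rw [show 4 * (i + 1) = 4 * (i + 1) - 1 + 1 by omega, harmonic_succ,
      show 4 * (i + 1) - 1 + 1 = 4 * (i + 1) by omega]
    push_cast
    rfl
  rw [show 2 * (2 * (i + 1)) = 4 * (i + 1) by ring, e1, e2] at h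
  push_cast at h
  have : (i : ℝ) + 1 ≠ 0 := by positivity
  have e : (4 * ((i : ℝ) + 1))⁻¹ = (2 * ((i : ℝ) + 1))⁻¹ / 2 := by field_simp; norm_num
  rw [e] at h
  linarith

/-- Each j stands for two steps of the recurrence. They involve O_{2j} and O_{2j+1} = O_{2j} +
1/(4j+1); the extra fraction makes the last sum. -/
lemma tailSum_odd (q : ℕ) :
    tailSum (2 * q + 1) = -tailSum 0 - 1
      + (1 - 1 / 2 * ∑ j ∈ Finset.Icc 1 q, 1 / ((j : ℝ) * (2 * j + 1))) * (Real.pi ^ 2 / 4)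
      - 1 / 8 * ∑ j ∈ Finset.Icc 1 q, (4 * (j : ℝ) + 1)
          * ((harmonic (2 * j - 1) : ℝ) - 2 * (harmonic (4 * j - 1) : ℝ))
          / ((j : ℝ) ^ 2 * (2 * (j : ℝ) + 1) ^ 2)
      - ∑ j ∈ Finset.Icc 1 q, 1 / ((2 * (j : ℝ) + 1) ^ 2 * (4 * (j : ℝ) + 1)) := by
  induction q with
  | zero =>
    rw [Nat.mul_zero, Nat.zero_add, tailSum_one]
    simp
    ring
  | succ q ih =>
    rw [show 2 * (q + 1) + 1 = 2 * q + 1 + 1 + 1 by ring, tailSum_succ, tailSum_succ, ih]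
    simp only [Finset.sum_Icc_succ_top (Nat.le_add_left 1 q)]
    rw [harmonic_sub_two_mul_harmonic (q + 1) (by omega), oddHarmonic_succ (2 * q + 1 + 1),
      show 2 * (q + 1) = 2 * q + 1 + 1 by ring]
    push_cast
    generalize oddHarmonic (2 * q + 1 + 1) = O
    have h1 : (q : ℝ) + 1 ≠ 0 := by positivity
    have h2 : 2 * (q : ℝ) + 1 + 1 + 1 ≠ 0 := by positivity
    have h3 : 2 * (2 * (q : ℝ) + 1 + 1) + 1 ≠ 0 := by positivity
    have h4 : 2 * (q : ℝ) + 1 + 1 ≠ 0 := by positivity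
    rw [show 2 * ((q : ℝ) + 1) + 1 = 2 * q + 1 + 1 + 1 by ring,
      show 4 * ((q : ℝ) + 1) + 1 = 2 * (2 * (q : ℝ) + 1 + 1) + 1 by ring]
    field_simp
    ring

/-- Here the two steps involve O_{2j+1} and O_{2j+2}. Expressing both through O_{2j} leaves
fractions in 4j+1 and 4j+3, whence the cubic numerator. -/
lemma tailSum_even (q : ℕ) :
    tailSum (2 * q + 2) = tailSum 0 - Real.pi ^ 2 / 8 + 2 / 3
      - 1 / 8 * ∑ j ∈ Finset.Icc 1 q, (4 * (j : ℝ) + 3)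
          * ((harmonic (2 * j - 1) : ℝ) - 2 * (harmonic (4 * j - 1) : ℝ))
          / (((j : ℝ) + 1) ^ 2 * (2 * (j : ℝ) + 1) ^ 2)
      - ∑ j ∈ Finset.Icc 1 q, (4 * (j : ℝ) ^ 3 + (j : ℝ) ^ 2 - 4 * (j : ℝ) - 2)
          / (((j : ℝ) + 1) ^ 2 * (2 * (j : ℝ) + 1) ^ 2 * (4 * (j : ℝ) + 3) * (4 * (j : ℝ) + 1))
      - Real.pi ^ 2 / 8 * ∑ j ∈ Finset.Icc 1 q, 1 / (((j : ℝ) + 1) * (2 * (j : ℝ) + 1)) := by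
  induction q with
  | zero =>
    rw [Nat.mul_zero, Nat.zero_add, tailSum_two]
    simp
  | succ q ih =>
    rw [show 2 * (q + 1) + 2 = 2 * q + 2 + 1 + 1 by ring, tailSum_succ, tailSum_succ, ih]
    simp only [Finset.sum_Icc_succ_top (Nat.le_add_left 1 q)]
    rw [harmonic_sub_two_mul_harmonic (q + 1) (by omega), oddHarmonic_succ (2 * q + 2 + 1),
      oddHarmonic_succ (2 * q + 2), show 2 * (q + 1) = 2 * q + 2 by ring]
    push_cast
    generalize oddHarmonic (2 * q + 2) = O
    have h1 : (q : ℝ) + 2 ≠ 0 := by positivity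
    have h2 : 2 * (q : ℝ) + 3 ≠ 0 := by positivity
    have h3 : 4 * (q : ℝ) + 5 ≠ 0 := by positivity
    have h4 : 4 * (q : ℝ) + 7 ≠ 0 := by positivity
    rw [show 2 * (q : ℝ) + 2 + 1 = 2 * q + 3 by ring,
      show 2 * (q : ℝ) + 3 + 1 = 2 * (q + 2) by ring,
      show 2 * ((q : ℝ) + 1) + 1 = 2 * q + 3 by ring,
      show (q : ℝ) + 1 + 1 = q + 2 by ring,
      show 2 * (2 * (q : ℝ) + 2) + 1 = 4 * q + 5 by ring,
      show 2 * (2 * (q : ℝ) + 3) + 1 = 4 * q + 7 by ring,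
      show 4 * ((q : ℝ) + 1) + 1 = 4 * q + 5 by ring,
      show 4 * ((q : ℝ) + 1) + 3 = 4 * q + 7 by ring]
    field_simp
    ring

/-! ### From `tailSum` to the stated formulas. -/

lemma sum_range_succ_eq_sum_Icc (f : ℕ → ℂ) (N : ℕ) :
    ∑ j ∈ Finset.range (N + 1), f j = f 0 + ∑ j ∈ Finset.Icc 1 N, f j := by
  rw [Finset.range_eq_Ico, Finset.sum_eq_sum_Ico_succ_bot (by omega)]
  rfl

lemma hasThetaOne_tailSum (m d : ℕ) :
    HasThetaOne (m + d) (2 * m + 1)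
      (tailSum d + (-1) ^ d * (Real.pi - 4 -
          4 * ∑ j ∈ Finset.Icc 1 d, (-1 : ℂ) ^ j / (2 * (j : ℂ) + 1))
        + (-1) ^ d * (∑ j ∈ Finset.Icc 1 m, (-1 : ℂ) ^ j / (2 * (j : ℂ) + 1) ^ 2) * Real.pi
        - 4 * ((-1) ^ d * ∑ k ∈ Finset.Icc 1 m, ∑ j ∈ Finset.Icc 0 (k + d),
            (-1 : ℂ) ^ (j + k) / ((2 * (j : ℂ) + 1) * (2 * (k : ℂ) + 1) ^ 2))) := by
  have h := Complex.hasSum_ofReal.2 (hasSum_tailSum d)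
  -- The terms K = 0, …, m are removed. K = 0 yields the separate bracket with π - 4, since the
  -- double sums start at k = 1.
  have h2 := (hasSum_nat_add_iff' (m + 1)).2 h
  have h3 : HasThetaOne (m + d) (2 * m + 1) _ := h2.congr_fun fun k => ?_
  · have ht : ∀ K : ℕ, ((leibnizTail (K + d) / (2 * (K : ℝ) + 1) ^ 2 : ℝ) : ℂ) =
        4 * ((-1) ^ d * ∑ j ∈ Finset.Icc 0 (K + d),
            (-1 : ℂ) ^ (j + K) / ((2 * (j : ℂ) + 1) * (2 * (K : ℂ) + 1) ^ 2)) -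
          (-1) ^ d * ((-1 : ℂ) ^ K / (2 * (K : ℂ) + 1) ^ 2) * Real.pi := by
      intro K
      have : ∑ j ∈ Finset.Icc 0 (K + d),
            (-1 : ℂ) ^ (j + K) / ((2 * (j : ℂ) + 1) * (2 * (K : ℂ) + 1) ^ 2) =
          (-1) ^ K / (2 * (K : ℂ) + 1) ^ 2 *
            ∑ j ∈ Finset.range (K + d + 1), (-1 : ℂ) ^ j / (2 * (j : ℂ) + 1) := by
        rw [Finset.mul_sum, Finset.range_eq_Ico]
        refine Finset.sum_congr rfl fun j _ => ?_
        rw [pow_add, div_mul_div_comm]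
        ring
      rw [this, leibnizTail]
      push_cast
      ring
    simp only [ht] at h3
    convert h3 using 1
    rw [sum_range_succ_eq_sum_Icc, Finset.sum_sub_distrib, ← Finset.sum_mul, ← Finset.mul_sum,
      ← Finset.mul_sum, ← Finset.mul_sum]
    have h0 : ∑ j ∈ Finset.Icc 0 (0 + d),
            (-1 : ℂ) ^ (j + 0) / ((2 * (j : ℂ) + 1) * (2 * ((0 : ℕ) : ℂ) + 1) ^ 2) =
        1 + ∑ j ∈ Finset.Icc 1 d, (-1 : ℂ) ^ j / (2 * (j : ℂ) + 1) := by
      have := sum_range_succ_eq_sum_Icc (fun j => (-1 : ℂ) ^ j / (2 * (j : ℂ) + 1)) d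
      simp only [Nat.cast_zero, mul_zero, pow_zero, zero_add, div_one] at this
      rw [← this, Nat.range_succ_eq_Icc_zero]
      simp
    rw [h0]
    simp only [Nat.cast_zero, mul_zero, zero_add, one_pow, pow_zero, div_one]
    ring
  · rw [digammaDiff_eq_leibnizTail]
    rw [show k + (m + 1) + d = k + 1 + (m + d) by ring]
    push_cast
    ring_nf

theorem theorem3 (m n : ℕ) (hm : 0 < m) (hmn : m ≤ n) :
    (n = m →
      HasThetaOne n (2 * m + 1)
        (-4
          - 4 * ∑ k ∈ Finset.Icc 1 m, ∑ j ∈ Finset.Icc 0 k,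
              (-1 : ℂ) ^ (j + k) / ((2 * (j : ℂ) + 1) * (2 * (k : ℂ) + 1) ^ 2)
          + (1 + ∑ j ∈ Finset.Icc 1 m, (-1 : ℂ) ^ j / (2 * (j : ℂ) + 1) ^ 2
              - (catalanConst : ℂ)) * (Real.pi : ℂ)
          + (Real.pi : ℂ) ^ 2 / 4 * (Real.log 2 : ℂ) + 7 / 4 * riemannZeta 3)) ∧
    (n = m + 1 →
      HasThetaOne n (2 * m + 1)
        (5 / 3
          + 4 * ∑ k ∈ Finset.Icc 1 m, ∑ j ∈ Finset.Icc 0 (k + 1),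
              (-1 : ℂ) ^ (j + k) / ((2 * (j : ℂ) + 1) * (2 * (k : ℂ) + 1) ^ 2)
          - (1 + ∑ j ∈ Finset.Icc 1 m, (-1 : ℂ) ^ j / (2 * (j : ℂ) + 1) ^ 2
              - (catalanConst : ℂ)) * (Real.pi : ℂ)
          + (Real.pi : ℂ) ^ 2 / 4 * (1 - (Real.log 2 : ℂ)) - 7 / 4 * riemannZeta 3)) ∧
    (n = m + 2 →
      HasThetaOne n (2 * m + 1)
        (-14 / 5
          - 4 * ∑ k ∈ Finset.Icc 1 m, ∑ j ∈ Finset.Icc 0 (k + 2),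
              (-1 : ℂ) ^ (j + k) / ((2 * (j : ℂ) + 1) * (2 * (k : ℂ) + 1) ^ 2)
          + (1 + ∑ j ∈ Finset.Icc 1 m, (-1 : ℂ) ^ j / (2 * (j : ℂ) + 1) ^ 2
              - (catalanConst : ℂ)) * (Real.pi : ℂ)
          + ((Real.log 2 : ℂ) - 1 / 2) * ((Real.pi : ℂ) ^ 2 / 4) + 7 / 4 * riemannZeta 3)) ∧
    (Odd (n - m) → n - m ≠ 1 →
      HasThetaOne n (2 * m + 1)
        (3
          - 1 / 8 * ∑ j ∈ Finset.Icc 1 ((n - m - 1) / 2),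
              (4 * (j : ℂ) + 1)
                * ((harmonic (2 * j - 1) : ℂ) - 2 * (harmonic (4 * j - 1) : ℂ))
                / ((j : ℂ) ^ 2 * (2 * (j : ℂ) + 1) ^ 2)
          - ∑ j ∈ Finset.Icc 1 ((n - m - 1) / 2),
              1 / ((2 * (j : ℂ) + 1) ^ 2 * (4 * (j : ℂ) + 1))
          - 4 * ∑ k ∈ Finset.Icc 1 m, ∑ j ∈ Finset.Icc 0 (k + (n - m)),
              (-1 : ℂ) ^ (k + (n - m) + j) / ((2 * (k : ℂ) + 1) ^ 2 * (2 * (j : ℂ) + 1))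
          + 4 * ∑ j ∈ Finset.Icc 1 (n - m), (-1 : ℂ) ^ j / (2 * (j : ℂ) + 1)
          + (-1
              - ∑ j ∈ Finset.Icc 1 m, (-1 : ℂ) ^ (j + (n - m) - 1) / (2 * (j : ℂ) + 1) ^ 2
              + (catalanConst : ℂ)) * (Real.pi : ℂ)
          + (1 - (Real.log 2 : ℂ)
              - 1 / 2 * ∑ j ∈ Finset.Icc 1 ((n - m - 1) / 2),
                  1 / ((j : ℂ) * (2 * (j : ℂ) + 1))) * ((Real.pi : ℂ) ^ 2 / 4)
          - 7 / 4 * riemannZeta 3)) ∧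
    (Even (n - m) → n - m ≠ 0 → n - m ≠ 2 →
      HasThetaOne n (2 * m + 1)
        (-10 / 3
          - 1 / 8 * ∑ j ∈ Finset.Icc 1 ((n - m - 2) / 2),
              (4 * (j : ℂ) + 3)
                * ((harmonic (2 * j - 1) : ℂ) - 2 * (harmonic (4 * j - 1) : ℂ))
                / (((j : ℂ) + 1) ^ 2 * (2 * (j : ℂ) + 1) ^ 2)
          - ∑ j ∈ Finset.Icc 1 ((n - m - 2) / 2),
              (4 * (j : ℂ) ^ 3 + (j : ℂ) ^ 2 - 4 * (j : ℂ) - 2)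
                / (((j : ℂ) + 1) ^ 2 * (2 * (j : ℂ) + 1) ^ 2
                    * (4 * (j : ℂ) + 3) * (4 * (j : ℂ) + 1))
          - 4 * ∑ k ∈ Finset.Icc 1 m, ∑ j ∈ Finset.Icc 0 (k + (n - m)),
              (-1 : ℂ) ^ (k + (n - m) + j) / ((2 * (k : ℂ) + 1) ^ 2 * (2 * (j : ℂ) + 1))
          - 4 * ∑ j ∈ Finset.Icc 1 (n - m), (-1 : ℂ) ^ j / (2 * (j : ℂ) + 1)
          - (-1
              + ∑ j ∈ Finset.Icc 1 m, (-1 : ℂ) ^ (j + (n - m) - 1) / (2 * (j : ℂ) + 1) ^ 2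
              + (catalanConst : ℂ)) * (Real.pi : ℂ)
          + (Real.pi : ℂ) ^ 2 / 4 * ((Real.log 2 : ℂ) - 1 / 2)
          - (Real.pi : ℂ) ^ 2 / 8 * ∑ j ∈ Finset.Icc 1 ((n - m - 2) / 2),
              1 / (((j : ℂ) + 1) * (2 * (j : ℂ) + 1))
          + 7 / 4 * riemannZeta 3)) := by
  have hswap : ∀ d, ∑ k ∈ Finset.Icc 1 m, ∑ j ∈ Finset.Icc 0 (k + d),
        (-1 : ℂ) ^ (k + d + j) / ((2 * (k : ℂ) + 1) ^ 2 * (2 * (j : ℂ) + 1)) =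
      (-1) ^ d * ∑ k ∈ Finset.Icc 1 m, ∑ j ∈ Finset.Icc 0 (k + d),
        (-1 : ℂ) ^ (j + k) / ((2 * (j : ℂ) + 1) * (2 * (k : ℂ) + 1) ^ 2) := by
    intro d
    simp only [Finset.mul_sum]
    refine Finset.sum_congr rfl fun k _ => Finset.sum_congr rfl fun j _ => ?_
    rw [mul_comm ((2 * (k : ℂ) + 1) ^ 2), ← mul_div_assoc]
    congr 1
    ring
  -- Writing n - m as e + 1 keeps the natural subtraction in the exponent from truncating.
  have hshift : ∀ e, ∑ j ∈ Finset.Icc 1 m, (-1 : ℂ) ^ (j + (e + 1) - 1) / (2 * (j : ℂ) + 1) ^ 2 =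
      (-1) ^ e * ∑ j ∈ Finset.Icc 1 m, (-1 : ℂ) ^ j / (2 * (j : ℂ) + 1) ^ 2 := by
    intro e
    rw [Finset.mul_sum]
    refine Finset.sum_congr rfl fun j _ => ?_
    rw [← mul_div_assoc, ← add_assoc, Nat.add_sub_cancel, pow_add, mul_comm]
  have hS := ofReal_tailSum_zero
  refine ⟨?_, ?_, ?_, ?_, ?_⟩
  · rintro rfl
    have h := hasThetaOne_tailSum n 0
    rw [hS, add_zero] at h
    convert h using 1
    simp
    ring
  · rintro rfl
    convert hasThetaOne_tailSum m 1 using 1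
    rw [tailSum_one]
    push_cast
    rw [hS]
    norm_num
    ring
  · rintro rfl
    convert hasThetaOne_tailSum m 2 using 1
    rw [tailSum_two, Finset.sum_Icc_succ_top (by norm_num : 1 ≤ 1 + 1)]
    push_cast
    rw [hS]
    norm_num
    ring
  · rintro ⟨q, hq⟩ -
    obtain rfl : n = m + (2 * q + 1) := by omega
    convert hasThetaOne_tailSum m (2 * q + 1) using 1
    rw [Nat.add_sub_cancel_left, hswap, hshift, tailSum_odd, Nat.add_sub_cancel,
      Nat.mul_div_cancel_left q two_pos, pow_succ, pow_mul, neg_one_sq, one_pow]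
    push_cast
    rw [hS]
    ring
  · rintro ⟨q, hq⟩ h0 -
    -- Since n - m is even and nonzero, it has the form 2q + 2 required by `tailSum_even`.
    obtain ⟨q, rfl⟩ := Nat.exists_eq_add_of_le' (show 1 ≤ q by omega)
    obtain rfl : n = m + (2 * q + 1 + 1) := by omega
    convert hasThetaOne_tailSum m (2 * q + 1 + 1) using 1
    rw [Nat.add_sub_cancel_left, hswap, hshift, show 2 * q + 1 + 1 = 2 * q + 2 by rfl, tailSum_even,
      Nat.add_sub_cancel, Nat.mul_div_cancel_left q two_pos, pow_succ, pow_succ, pow_succ, pow_mul,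
      neg_one_sq, one_pow]
    push_cast
    rw [hS]
    ring
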